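/- **Theorem (mixing time bound).** Let $1 \le m \le n$ and let $G$ be the complete bipartite graph with vertex classes $V_1$, $V_2$, $|V_1| = m$, $|V_2| = n$. Let $\mathcal N$ be the set of perfect matchings of $G$, i.e. of the maximal matchings (each has $m$ edges). Let $U : \mathcal N \to \mathbb R$ be arbitrary, with maximum $U_{\max}$ and minimum $U_{\min}$, let $\beta \in [0,\infty)$, and put $\alpha = \exp\{\beta(U_{\max}-U_{\min})\}$. Consider the following Markov chain $\mathcal M$ on $\mathcal N$. In state $M$, choose $y \in V_1$ and $z \in V_2$ independently and uniformly at random, and define a proposal $\tilde M$: if $(y,z)\in M$, then $\tilde M = M$; if $(y,z_1) \in M$ and $z$ is unmatched, then $\tilde M = (M \cup\{(y,z)\})\setminus\{(y,z_1)\}$; if $(y,z_1),(y_1,z)\in M$ with $y_1 \ne y$, then $\tilde M = (M\cup\{(y,z),(y_1,z_1)\})\setminus\{(y,z_1),(y_1,z)\}$. Move to $\tilde M$ with probability $a(M,\tilde M) = \min\{1, e^{\beta(U(\tilde M)-U(M))}\}$, and otherwise stay at $M$. Let $P$ be the transition matrix of $\mathcal M$. Then the Gibbs distribution $\pi_M =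 e^{\beta U(M)}/\sum_{M'\in\mathcal N} e^{\beta U(M')}$ is the unique stationary distribution of $P$. Moreover, with $$d(t) = \tfrac12 \max_{M'\in\mathcal N}\sum_{M\in\mathcal N}\bigl|(P^{t})_{M'M}-\pi_M\bigr| ,$$ for every $0<\varepsilon\le 1$ the $\varepsilon$-mixing time $\tau_\varepsilon = \min\{t \in \{0,1,2,\dots\} : d(t)\le\varepsilon\}$ exists and satisfies $$\tau_\varepsilon \le 32\, m^2 n^2 \alpha^6 \bigl(\beta(U_{\max}-U_{\min}) + m \ln n + \ln \varepsilon^{-1}\bigr).$$ The same two assertions hold for the lazy form of the chain, in which each state $M' \neq M$ that can be proposed from $M$ is entered with probability $\frac{1}{2mn}\,a(M,M')$, and the chain stays at $M$ with the remaining probability. -/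

import Mathlib

namespace MatchingChain

/-- A matching of the complete bipartite graph on `Fin m` and `Fin n`: a set of edges `(y, z)`,
no two of which share an endpoint. -/
def IsMatching {m n : ℕ} (M : Finset (Fin m × Fin n)) : Prop :=
  ∀ e ∈ M, ∀ f ∈ M, e ≠ f → e.1 ≠ f.1 ∧ e.2 ≠ f.2

/-- A perfect matching: a matching to which no further edge can be added. -/
def IsPerfectMatching {m n : ℕ} (M : Finset (Fin m × Fin n)) : Prop :=
  IsMatching M ∧ ∀ e : Fin m × Fin n, e ∉ M → ¬ IsMatching (insert e M)

instance {m n : ℕ} : DecidablePred (IsMatching (m := m) (n := n)) := fun M => by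
  unfold IsMatching; infer_instance

instance {m n : ℕ} : DecidablePred (IsPerfectMatching (m := m) (n := n)) := fun M => by
  unfold IsPerfectMatching; infer_instance

/-- The state space: all perfect matchings. -/
abbrev PerfectMatching (m n : ℕ) : Type :=
  {M : Finset (Fin m × Fin n) // IsPerfectMatching M}

/-- The edge set proposed from `M` when the nodes `y` and `z` are selected: the edges of `M` at
`y` or at `z` are removed, the edge `(y, z)` is added, and if `(y, z₁)` and `(y₁, z)` are both in
`M` then `(y₁, z₁)` is added too.
So if `(y, z) ∈ M` the result is `M`; if `(y, z₁) ∈ M` and `z` is unmatched it is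
`(M ∪ {(y, z)}) \ {(y, z₁)}`; if `(y, z₁), (y₁, z) ∈ M` with `y₁ ≠ y` it is
`(M ∪ {(y, z), (y₁, z₁)}) \ {(y, z₁), (y₁, z)}`. -/
def proposalEdges {m n : ℕ} (M : Finset (Fin m × Fin n)) (y : Fin m) (z : Fin n) :
    Finset (Fin m × Fin n) :=
  {e ∈ M | e.1 ≠ y ∧ e.2 ≠ z} ∪ {(y, z)} ∪
    Finset.univ.filter (fun e : Fin m × Fin n => (y, e.2) ∈ M ∧ (e.1, z) ∈ M)

theorem mem_proposalEdges {m n : ℕ} {M : Finset (Fin m × Fin n)} {y : Fin m} {z : Fin n}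
    {a : Fin m} {b : Fin n} :
    (a, b) ∈ proposalEdges M y z ↔
      ((a, b) ∈ M ∧ a ≠ y ∧ b ≠ z) ∨ (a = y ∧ b = z) ∨ ((y, b) ∈ M ∧ (a, z) ∈ M) := by
  simp only [proposalEdges, Finset.mem_union, Finset.mem_filter, Finset.mem_singleton,
    Finset.mem_univ, true_and, Prod.mk.injEq, or_assoc, ne_eq]

theorem isMatching_iff {m n : ℕ} {M : Finset (Fin m × Fin n)} :
    IsMatching M ↔
      (∀ a b b', (a, b) ∈ M → (a, b') ∈ M → b = b') ∧
      (∀ a a' b, (a, b) ∈ M → (a', b) ∈ M → a = a') := by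
  constructor
  · intro h
    constructor
    · intro a b b' h1 h2
      by_contra hne
      exact (h _ h1 _ h2 (by simpa using hne)).1 rfl
    · intro a a' b h1 h2
      by_contra hne
      exact (h _ h1 _ h2 (by simpa using hne)).2 rfl
  · rintro ⟨h1, h2⟩ ⟨a, b⟩ he ⟨a', b'⟩ hf hne
    constructor
    · rintro rfl
      exact hne (by rw [h1 _ _ _ he hf])
    · rintro rfl
      exact hne (by rw [h2 _ _ _ he hf])

theorem isPerfectMatching_iff {m n : ℕ} {M : Finset (Fin m × Fin n)} :
    IsPerfectMatching M ↔
      IsMatching M ∧ ∀ a b, (∃ b', (a, b') ∈ M) ∨ (∃ a', (a', b) ∈ M) := by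
  constructor
  · rintro ⟨h, hmax⟩
    refine ⟨h, fun a b => ?_⟩
    by_contra hc
    push Not at hc
    obtain ⟨h1, h2⟩ := hc
    refine hmax (a, b) (h1 b) ?_
    rw [isMatching_iff] at h ⊢
    obtain ⟨g1, g2⟩ := h
    simp only [Finset.mem_insert, Prod.mk.injEq]
    constructor <;> grind
  · rintro ⟨h, hmax⟩
    refine ⟨h, ?_⟩
    rintro ⟨a, b⟩ hab hm
    rw [isMatching_iff] at hm
    obtain ⟨g1, g2⟩ := hm
    rcases hmax a b with ⟨b', hb⟩ | ⟨a', ha⟩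
    · have := g1 a b b' (by simp) (by simp [hb])
      exact hab (this ▸ hb)
    · have := g2 a a' b (by simp) (by simp [ha])
      exact hab (this ▸ ha)

theorem isPerfectMatching_proposalEdges {m n : ℕ} {M : Finset (Fin m × Fin n)}
    (hM : IsPerfectMatching M) (y : Fin m) (z : Fin n) :
    IsPerfectMatching (proposalEdges M y z) := by
  rw [isPerfectMatching_iff, isMatching_iff] at hM ⊢
  obtain ⟨⟨h1, h2⟩, h3⟩ := hM
  simp only [mem_proposalEdges]
  refine ⟨⟨?_, ?_⟩, ?_⟩
  · grind
  · grind
  · intro a b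
    have e1 := h3 a b
    have e2 := h3 y b
    have e3 := h3 a z
    grind

/-- The proposed perfect matching when the nodes `y` and `z` are selected in state `M`. -/
def propose {m n : ℕ} (M : PerfectMatching m n) (y : Fin m) (z : Fin n) : PerfectMatching m n :=
  ⟨proposalEdges M.1 y z, isPerfectMatching_proposalEdges M.2 y z⟩

/-- The probability of accepting the proposal `M'` in state `M`. -/
noncomputable def acceptProb {m n : ℕ} (β : ℝ) (U : PerfectMatching m n → ℝ)
    (M M' : PerfectMatching m n) : ℝ :=
  min 1 (Real.exp (β * (U M' - U M)))

/-- The transition matrix of the algorithm (entry `M M'`: the probability of going from `M` to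
`M'`): select `(y, z)` uniformly at random, move to the proposal with the acceptance probability,
and stay at `M` otherwise. -/
noncomputable def algorithmMatrix {m n : ℕ} (β : ℝ) (U : PerfectMatching m n → ℝ) :
    Matrix (PerfectMatching m n) (PerfectMatching m n) ℝ :=
  fun M M' => ∑ y : Fin m, ∑ z : Fin n, 1 / ((m : ℝ) * n) *
    ((if propose M y z = M' then acceptProb β U M (propose M y z) else 0) +
      (if M = M' then 1 - acceptProb β U M (propose M y z) else 0))

/-- Two distinct states are adjacent if one step of the algorithm can propose the second from the
first. -/
def Adjacent {m n : ℕ} (M M' : PerfectMatching m n) : Prop :=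
  M ≠ M' ∧ ∃ y z, propose M y z = M'

instance {m n : ℕ} : DecidableRel (Adjacent (m := m) (n := n)) := fun M M' => by
  unfold Adjacent; infer_instance

/-- The lazy form of the transition matrix: every adjacent state `M'` is entered from `M` with
probability `a(M, M') / (2mn)`, and the remaining probability (at least `1/2`) is that of staying
at `M`. -/
noncomputable def lazyMatrix {m n : ℕ} (β : ℝ) (U : PerfectMatching m n → ℝ) :
    Matrix (PerfectMatching m n) (PerfectMatching m n) ℝ :=
  fun M M' =>
    if M = M' then
      1 - ∑ N : PerfectMatching m n,
        if Adjacent M N then 1 / (2 * (m : ℝ) * n) * acceptProb β U M N else 0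
    else if Adjacent M M' then 1 / (2 * (m : ℝ) * n) * acceptProb β U M M' else 0

/-- The Gibbs distribution. -/
noncomputable def gibbs {m n : ℕ} (β : ℝ) (U : PerfectMatching m n → ℝ) :
    PerfectMatching m n → ℝ :=
  fun M => Real.exp (β * U M) / ∑ M' : PerfectMatching m n, Real.exp (β * U M')

/-- `π` is a stationary distribution of the chain with transition matrix `P`. -/
def IsStationaryDistribution {S : Type*} [Fintype S] (P : Matrix S S ℝ) (π : S → ℝ) : Prop :=
  (∀ x, 0 ≤ π x) ∧ ∑ x, π x = 1 ∧ Matrix.vecMul π P = π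

/-- The total variation distance `d(t)` of the `t`-step transition probabilities from `π`, for the
worst initial state. -/
noncomputable def tvDistance {S : Type*} [Fintype S] [DecidableEq S] (P : Matrix S S ℝ)
    (π : S → ℝ) (t : ℕ) : ℝ :=
  1 / 2 * ⨆ x : S, ∑ y : S, |(P ^ t) x y - π y|

/-- `τ` is the `ε`-mixing time: the least `t` with `d(t) ≤ ε`. -/
def IsMixingTime {S : Type*} [Fintype S] [DecidableEq S] (P : Matrix S S ℝ)
    (π : S → ℝ) (ε : ℝ) (τ : ℕ) : Prop :=
  IsLeast {t : ℕ | tvDistance P π t ≤ ε} τ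

/-- The maximal utility of a perfect matching. -/
noncomputable def Umax {m n : ℕ} (U : PerfectMatching m n → ℝ) : ℝ := ⨆ M, U M

/-- The minimal utility of a perfect matching. -/
noncomputable def Umin {m n : ℕ} (U : PerfectMatching m n → ℝ) : ℝ := ⨅ M, U M

/-- `α = exp(β (U_max - U_min))`. -/
noncomputable def alpha {m n : ℕ} (β : ℝ) (U : PerfectMatching m n → ℝ) : ℝ :=
  Real.exp (β * (Umax U - Umin U))

end MatchingChain

/-!
Identify perfect matchings with injections `Fin m ↪ Fin n`: a proposal is then composition with a
transposition of `Fin n`. The group `Perm (Fin n)` acts transitively on the injections, and each of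
its elements is a product of at most `n` transpositions; the triangle inequality in `ℓ²` therefore
bounds `∑ (F M - F M')²` over all pairs of states by the same sum over adjacent pairs, which is a
Poincaré inequality for the uniform distribution. Since the Gibbs distribution is uniform up to the
factor `α`, comparing variances and Dirichlet forms transfers the inequality to the chain at the
price of a factor `α`. Together with a lower bound on the holding probabilities, which keeps the
spectrum away from `-1`, this is an absolute spectral gap, and a reversible chain with gap `δ` and
stationary weights at least `p` mixes within `δ⁻¹ log (p ε)⁻¹` steps.
-/

namespace MatchingChain

section Reversible

open Matrix

variable {S : Type*} [Fintype S] {P : Matrix S S ℝ} {π f : S → ℝ} {δ : ℝ}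

/-- The Dirichlet form of a chain with transition matrix `P` and stationary distribution `π`. -/
noncomputable def dirichletForm (P : Matrix S S ℝ) (π f : S → ℝ) : ℝ :=
  1 / 2 * ∑ x, ∑ y, π x * P x y * (f x - f y) ^ 2

theorem dotProduct_sq_sub_const (hπ : ∑ x, π x = 1) (hf : π ⬝ᵥ f = 0) (c : ℝ) :
    ∑ x, π x * (f x - c) ^ 2 = π ⬝ᵥ f ^ 2 + c ^ 2 := by
  calc ∑ x, π x * (f x - c) ^ 2 = ∑ x, (π x * f x ^ 2 - 2 * c * (π x * f x) + c ^ 2 * π x) :=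
        Finset.sum_congr rfl fun x _ => by ring
    _ = π ⬝ᵥ f ^ 2 - 2 * c * π ⬝ᵥ f + c ^ 2 * ∑ x, π x := by
        simp only [Finset.sum_add_distrib, Finset.sum_sub_distrib, ← Finset.mul_sum, dotProduct,
          Pi.pow_apply]
    _ = π ⬝ᵥ f ^ 2 + c ^ 2 := by rw [hf, hπ]; ring

variable [DecidableEq S]

/-- `P` is the transition matrix of a Markov chain that is reversible with respect to the
probability vector `π`, all of whose entries are positive. -/
structure IsReversible (P : Matrix S S ℝ) (π : S → ℝ) : Prop where
  mem_rowStochastic : P ∈ rowStochastic ℝ S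
  pos (x : S) : 0 < π x
  sum_eq_one : ∑ x, π x = 1
  balance (x y : S) : π x * P x y = π y * P y x

/-- A reversible chain with absolute spectral gap at least `δ`: on functions of `π`-mean zero the
Rayleigh quotients of `P` in `ℓ²(π)` lie in `[-(1 - δ), 1 - δ]`. -/
structure HasAbsoluteGap (P : Matrix S S ℝ) (π : S → ℝ) (δ : ℝ) : Prop
    extends IsReversible P π where
  abs_rayleigh_le (f : S → ℝ) : π ⬝ᵥ f = 0 → |π ⬝ᵥ (f * P *ᵥ f)| ≤ (1 - δ) * π ⬝ᵥ f ^ 2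

namespace IsReversible

theorem nonneg (h : IsReversible P π) (x y : S) : 0 ≤ P x y :=
  nonneg_of_mem_rowStochastic h.mem_rowStochastic

theorem nonempty (h : IsReversible P π) : Nonempty S := by
  by_contra hS
  have := not_nonempty_iff.1 hS
  simpa using h.sum_eq_one

theorem le_one_of_forall_le (h : IsReversible P π) {p : ℝ} (hπ : ∀ x, p ≤ π x) :
    p ≤ 1 := by
  obtain ⟨x⟩ := h.nonempty
  calc p ≤ π x := hπ x
    _ ≤ ∑ y, π y := Finset.single_le_sum (fun y _ => (h.pos y).le) (Finset.mem_univ x)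
    _ = 1 := h.sum_eq_one

theorem dotProduct_sq_nonneg (h : IsReversible P π) (f : S → ℝ) : 0 ≤ π ⬝ᵥ f ^ 2 :=
  Finset.sum_nonneg fun x _ => mul_nonneg (h.pos x).le (sq_nonneg (f x))

theorem eq_zero_of_dotProduct_sq_nonpos (h : IsReversible P π) (hf : π ⬝ᵥ f ^ 2 ≤ 0) : f = 0 := by
  have hterm := (Finset.sum_eq_zero_iff_of_nonneg fun x _ =>
    mul_nonneg (h.pos x).le (sq_nonneg (f x))).1 (hf.antisymm (h.dotProduct_sq_nonneg f))
  funext x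
  simpa [(h.pos x).ne'] using hterm x (Finset.mem_univ x)

theorem pow (h : IsReversible P π) (t : ℕ) : IsReversible (P ^ t) π where
  mem_rowStochastic := pow_mem h.mem_rowStochastic t
  pos := h.pos
  sum_eq_one := h.sum_eq_one
  balance x y := by
    have hsemi : SemiconjBy (diagonal π) P Pᵀ := by
      ext x y
      rw [diagonal_mul, mul_diagonal, transpose_apply, h.balance, mul_comm]
    have hpow := congrFun₂ (hsemi.pow_right t).eq x y
    rw [diagonal_mul, mul_diagonal, ← transpose_pow, transpose_apply] at hpow
    exact hpow.trans (mul_comm _ _)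

/-- Passing to densities with respect to `π` turns the evolution of measures into that of
functions. -/
theorem mul_vecMul (h : IsReversible P π) (f : S → ℝ) : (π * f) ᵥ* P = π * P *ᵥ f := by
  funext y
  simp only [vecMul, mulVec, dotProduct, Pi.mul_apply, Finset.mul_sum]
  exact Finset.sum_congr rfl fun x _ => by linear_combination f x * h.balance x y

theorem vecMul_eq (h : IsReversible P π) : π ᵥ* P = π := by
  simpa [one_vecMul_of_mem_rowStochastic h.mem_rowStochastic] using h.mul_vecMul 1

theorem isStationaryDistribution (h : IsReversible P π) : IsStationaryDistribution P π :=
  ⟨fun x => (h.pos x).le, h.sum_eq_one, h.vecMul_eq⟩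

theorem dotProduct_mulVec (h : IsReversible P π) (f : S → ℝ) : π ⬝ᵥ P *ᵥ f = π ⬝ᵥ f := by
  rw [Matrix.dotProduct_mulVec, h.vecMul_eq]

theorem dotProduct_mul_mulVec_comm (h : IsReversible P π) (f g : S → ℝ) :
    π ⬝ᵥ (f * P *ᵥ g) = π ⬝ᵥ (P *ᵥ f * g) := by
  have hassoc (a b : S → ℝ) : π ⬝ᵥ (a * b) = (π * a) ⬝ᵥ b := by
    simp only [dotProduct, Pi.mul_apply, mul_assoc]
  rw [hassoc, hassoc, Matrix.dotProduct_mulVec, h.mul_vecMul]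

theorem sum_sum_mul_add_mul_sq (h : IsReversible P π) (f : S → ℝ) (s : ℝ) :
    ∑ x, ∑ y, π x * P x y * (f x + s * f y) ^ 2 =
      (1 + s ^ 2) * π ⬝ᵥ f ^ 2 + 2 * s * π ⬝ᵥ (f * P *ᵥ f) := by
  have hfst : ∑ x, ∑ y, π x * P x y * f x ^ 2 = π ⬝ᵥ f ^ 2 := by
    refine Finset.sum_congr rfl fun x _ => ?_
    rw [← Finset.sum_mul, ← Finset.mul_sum, sum_row_of_mem_rowStochastic h.mem_rowStochastic,
      mul_one, Pi.pow_apply]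
  have hsnd : ∑ x, ∑ y, π x * P x y * f y ^ 2 = π ⬝ᵥ f ^ 2 := by
    rw [← hfst, Finset.sum_comm]
    simp only [h.balance]
  have hcross : ∑ x, ∑ y, π x * P x y * (f x * f y) = π ⬝ᵥ (f * P *ᵥ f) := by
    simp only [mulVec, dotProduct, Pi.mul_apply, Finset.mul_sum]
    exact Finset.sum_congr rfl fun x _ => Finset.sum_congr rfl fun y _ => by ring
  calc ∑ x, ∑ y, π x * P x y * (f x + s * f y) ^ 2
      = ∑ x, ∑ y, (π x * P x y * f x ^ 2 + s ^ 2 * (π x * P x y * f y ^ 2)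
          + 2 * s * (π x * P x y * (f x * f y))) :=
        Finset.sum_congr rfl fun x _ => Finset.sum_congr rfl fun y _ => by ring
    _ = _ := by
        simp only [Finset.sum_add_distrib, ← Finset.mul_sum, hfst, hsnd, hcross]
        ring

theorem dirichletForm_eq (h : IsReversible P π) (f : S → ℝ) :
    dirichletForm P π f = π ⬝ᵥ f ^ 2 - π ⬝ᵥ (f * P *ᵥ f) := by
  have hexpand := h.sum_sum_mul_add_mul_sq f (-1)
  simp only [neg_one_mul, ← sub_eq_add_neg] at hexpand
  rw [dirichletForm, hexpand]
  ring

/-- The holding probabilities keep the spectrum away from `-1`. -/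
theorem neg_le_dotProduct_mul_mulVec (h : IsReversible P π) (hdiag : ∀ x, δ ≤ 2 * P x x)
    (f : S → ℝ) : -((1 - δ) * π ⬝ᵥ f ^ 2) ≤ π ⬝ᵥ (f * P *ᵥ f) := by
  have hexpand := h.sum_sum_mul_add_mul_sq f 1
  have hself : 2 * δ * π ⬝ᵥ f ^ 2 ≤ ∑ x, ∑ y, π x * P x y * (f x + 1 * f y) ^ 2 := by
    rw [dotProduct, Finset.mul_sum]
    refine Finset.sum_le_sum fun x _ => ?_
    have hterm (y : S) : 0 ≤ π x * P x y * (f x + 1 * f y) ^ 2 :=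
      mul_nonneg (mul_nonneg (h.pos x).le (h.nonneg x y)) (sq_nonneg _)
    calc 2 * δ * (π x * f x ^ 2) ≤ 2 * (2 * P x x) * (π x * f x ^ 2) := by
          gcongr
          · exact mul_nonneg (h.pos x).le (sq_nonneg _)
          · exact hdiag x
      _ = π x * P x x * (f x + 1 * f x) ^ 2 := by ring
      _ ≤ _ := Finset.single_le_sum (fun y _ => hterm y) (Finset.mem_univ x)
  linarith

theorem hasAbsoluteGap (h : IsReversible P π)
    (poincare : ∀ f : S → ℝ, π ⬝ᵥ f = 0 → δ * π ⬝ᵥ f ^ 2 ≤ dirichletForm P π f)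
    (hdiag : ∀ x, δ ≤ 2 * P x x) : HasAbsoluteGap P π δ where
  toIsReversible := h
  abs_rayleigh_le f hf := by
    have hpoincare := poincare f hf
    rw [h.dirichletForm_eq] at hpoincare
    exact abs_le.2 ⟨h.neg_le_dotProduct_mul_mulVec hdiag f, by linarith⟩

theorem mul_sum_le_dirichletForm (h : IsReversible P π) {r : S → S → Prop} [DecidableRel r]
    {q : ℝ} (hq : ∀ x y, r x y → q ≤ π x * P x y) (f : S → ℝ) :
    q * ∑ x, ∑ y with r x y, (f x - f y) ^ 2 ≤ 2 * dirichletForm P π f := by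
  have hterm (x y : S) : 0 ≤ π x * P x y * (f x - f y) ^ 2 :=
    mul_nonneg (mul_nonneg (h.pos x).le (h.nonneg x y)) (sq_nonneg _)
  calc q * ∑ x, ∑ y with r x y, (f x - f y) ^ 2
      ≤ ∑ x, ∑ y with r x y, π x * P x y * (f x - f y) ^ 2 := by
        simp only [Finset.mul_sum]
        exact Finset.sum_le_sum fun x _ => Finset.sum_le_sum fun y hy =>
          mul_le_mul_of_nonneg_right (hq x y (Finset.mem_filter.1 hy).2) (sq_nonneg _)
    _ ≤ ∑ x, ∑ y, π x * P x y * (f x - f y) ^ 2 := Finset.sum_le_sum fun x _ =>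
        Finset.sum_le_sum_of_subset_of_nonneg (Finset.filter_subset _ _) fun y _ _ => hterm x y
    _ = 2 * dirichletForm P π f := by rw [dirichletForm]; ring

/-- A Holley–Stroock comparison: if `π` is uniform up to the factor `α`, a Poincaré inequality for
the uniform measure on the graph `r` passes to every reversible chain that uses the edges of `r`. -/
theorem mul_dotProduct_sq_le_dirichletForm (h : IsReversible P π) {r : S → S → Prop}
    [DecidableRel r] {α c K : ℝ} (hα : ∀ x y, π x ≤ α * π y) (hc : 0 ≤ c) (hK : 0 ≤ K)
    (hr : ∀ x y, r x y → c * min (π x) (π y) ≤ π x * P x y) (hf : π ⬝ᵥ f = 0)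
    (poincare : ∑ x, ∑ y, (f x - f y) ^ 2 ≤
      Fintype.card S * (K * ∑ x, ∑ y with r x y, (f x - f y) ^ 2)) :
    c * π ⬝ᵥ f ^ 2 ≤ 2 * (α * K) * dirichletForm P π f := by
  have := h.nonempty
  set A := ∑ x, ∑ y with r x y, (f x - f y) ^ 2
  obtain ⟨x₀, hmin⟩ := Finite.exists_min π
  have hα₀ : 0 ≤ α := nonneg_of_mul_nonneg_left ((h.pos x₀).le.trans (hα x₀ x₀)) (h.pos x₀)
  have henergy : c * π x₀ * A ≤ 2 * dirichletForm P π f :=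
    h.mul_sum_le_dirichletForm (fun x y hxy =>
      (mul_le_mul_of_nonneg_left (le_min (hmin x) (hmin y)) hc).trans (hr x y hxy)) f
  have hvariance : Fintype.card S * π ⬝ᵥ f ^ 2 ≤ Fintype.card S * (α * π x₀ * (K * A)) := by
    calc Fintype.card S * π ⬝ᵥ f ^ 2 = ∑ _y : S, π ⬝ᵥ f ^ 2 := by simp
      _ ≤ ∑ y, ∑ x, π x * (f x - f y) ^ 2 := Finset.sum_le_sum fun y _ => by
          rw [dotProduct_sq_sub_const h.sum_eq_one hf]
          exact le_add_of_nonneg_right (sq_nonneg _)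
      _ = ∑ x, ∑ y, π x * (f x - f y) ^ 2 := Finset.sum_comm
      _ ≤ ∑ x, ∑ y, α * π x₀ * (f x - f y) ^ 2 := by gcongr with x; exact hα x x₀
      _ = α * π x₀ * ∑ x, ∑ y, (f x - f y) ^ 2 := by simp only [Finset.mul_sum]
      _ ≤ α * π x₀ * (Fintype.card S * (K * A)) :=
          mul_le_mul_of_nonneg_left poincare (mul_nonneg hα₀ (h.pos x₀).le)
      _ = Fintype.card S * (α * π x₀ * (K * A)) := by ring
  calc c * π ⬝ᵥ f ^ 2 ≤ c * (α * π x₀ * (K * A)) :=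
        mul_le_mul_of_nonneg_left
          (le_of_mul_le_mul_left hvariance (by exact_mod_cast Fintype.card_pos)) hc
    _ = α * K * (c * π x₀ * A) := by ring
    _ ≤ α * K * (2 * dirichletForm P π f) := mul_le_mul_of_nonneg_left henergy (mul_nonneg hα₀ hK)
    _ = 2 * (α * K) * dirichletForm P π f := by ring

theorem row_sub_eq (h : IsReversible P π) (x : S) :
    P.row x - π = π * P *ᵥ (Pi.single x (π x)⁻¹ - 1) := by
  have hsingle : π * Pi.single x (π x)⁻¹ = Pi.single x 1 := by
    funext y
    rcases eq_or_ne y x with rfl | hyx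
    · simp [(h.pos y).ne']
    · simp [hyx]
  rw [← h.mul_vecMul, mul_sub, hsingle, mul_one, sub_vecMul, single_one_vecMul, h.vecMul_eq]

theorem dotProduct_single_inv_sub_one (h : IsReversible P π) (x : S) :
    π ⬝ᵥ (Pi.single x (π x)⁻¹ - 1) = 0 := by
  rw [dotProduct_sub, dotProduct_single, dotProduct_one, h.sum_eq_one,
    mul_inv_cancel₀ (h.pos x).ne', sub_self]

theorem dotProduct_single_inv_sub_one_sq_le (h : IsReversible P π) (x : S) :
    π ⬝ᵥ (Pi.single x (π x)⁻¹ - 1) ^ 2 ≤ (π x)⁻¹ := by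
  have hshift := dotProduct_sq_sub_const h.sum_eq_one (h.dotProduct_single_inv_sub_one x) (-1)
  have hsq : ∑ y, π y * ((Pi.single x (π x)⁻¹ - 1 : S → ℝ) y - -1) ^ 2 = (π x)⁻¹ := by
    have hx := (h.pos x).ne'
    rw [Finset.sum_eq_single x (by simp +contextual) (by simp)]
    simp
    field_simp
  linarith

end IsReversible

namespace HasAbsoluteGap

/-- With `c = 1 - δ`, `g = c f - P f` and `k = c f + P f` one has, in `ℓ²(π)`,
`2 c (c² ‖f‖² - ‖P f‖²) = (c ‖g‖² + ⟨g, P g⟩) + (c ‖k‖² - ⟨k, P k⟩)`. -/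
theorem dotProduct_mulVec_sq_le (h : HasAbsoluteGap P π δ) (hδ : δ < 1) (hf : π ⬝ᵥ f = 0) :
    π ⬝ᵥ (P *ᵥ f) ^ 2 ≤ (1 - δ) ^ 2 * π ⬝ᵥ f ^ 2 := by
  set c := 1 - δ
  have hmean (s : ℝ) : π ⬝ᵥ (c • f + s • P *ᵥ f) = 0 := by
    rw [dotProduct_add, dotProduct_smul, dotProduct_smul, h.dotProduct_mulVec, hf]
    simp
  have hnorm (s : ℝ) : π ⬝ᵥ (c • f + s • P *ᵥ f) ^ 2 =
      c ^ 2 * π ⬝ᵥ f ^ 2 + 2 * c * s * π ⬝ᵥ (f * P *ᵥ f) + s ^ 2 * π ⬝ᵥ (P *ᵥ f) ^ 2 := by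
    simp only [dotProduct, Finset.mul_sum, ← Finset.sum_add_distrib]
    exact Finset.sum_congr rfl fun x _ => by
      simp only [Pi.pow_apply, Pi.add_apply, Pi.smul_apply, Pi.mul_apply, smul_eq_mul]; ring
  have hform (s : ℝ) : π ⬝ᵥ ((c • f + s • P *ᵥ f) * P *ᵥ (c • f + s • P *ᵥ f)) =
      c ^ 2 * π ⬝ᵥ (f * P *ᵥ f) + 2 * c * s * π ⬝ᵥ (P *ᵥ f) ^ 2
        + s ^ 2 * π ⬝ᵥ (P *ᵥ f * P *ᵥ P *ᵥ f) := by
    have hsymm : π ⬝ᵥ (f * P *ᵥ P *ᵥ f) = π ⬝ᵥ (P *ᵥ f) ^ 2 := by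
      rw [h.dotProduct_mul_mulVec_comm, sq]
    calc _ = c ^ 2 * π ⬝ᵥ (f * P *ᵥ f) + c * s * π ⬝ᵥ (P *ᵥ f) ^ 2
          + c * s * π ⬝ᵥ (f * P *ᵥ P *ᵥ f) + s ^ 2 * π ⬝ᵥ (P *ᵥ f * P *ᵥ P *ᵥ f) := by
          simp only [mulVec_add, mulVec_smul]
          simp only [dotProduct, Finset.mul_sum, ← Finset.sum_add_distrib]
          exact Finset.sum_congr rfl fun x _ => by
            simp only [Pi.pow_apply, Pi.add_apply, Pi.smul_apply, Pi.mul_apply, smul_eq_mul]; ring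
      _ = _ := by rw [hsymm]; ring
  have hlower := (abs_le.1 (h.abs_rayleigh_le _ (hmean (-1)))).1
  have hupper := (abs_le.1 (h.abs_rayleigh_le _ (hmean 1))).2
  rw [hnorm, hform] at hlower hupper
  have hmul : c * π ⬝ᵥ (P *ᵥ f) ^ 2 ≤ c * (c ^ 2 * π ⬝ᵥ f ^ 2) := by linarith
  exact le_of_mul_le_mul_left hmul (by linarith)

theorem dotProduct_pow_mulVec_sq_le (h : HasAbsoluteGap P π δ) (hδ : δ < 1) (hf : π ⬝ᵥ f = 0)
    (t : ℕ) : π ⬝ᵥ (P ^ t *ᵥ f) ^ 2 ≤ ((1 - δ) ^ t) ^ 2 * π ⬝ᵥ f ^ 2 := by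
  induction t with
  | zero => simp
  | succ t ih =>
    have hmean : π ⬝ᵥ P ^ t *ᵥ f = 0 := by rw [(h.pow t).dotProduct_mulVec, hf]
    calc π ⬝ᵥ (P ^ (t + 1) *ᵥ f) ^ 2 = π ⬝ᵥ (P *ᵥ P ^ t *ᵥ f) ^ 2 := by
          rw [mulVec_mulVec, ← pow_succ']
      _ ≤ (1 - δ) ^ 2 * π ⬝ᵥ (P ^ t *ᵥ f) ^ 2 := h.dotProduct_mulVec_sq_le hδ hmean
      _ ≤ (1 - δ) ^ 2 * (((1 - δ) ^ t) ^ 2 * π ⬝ᵥ f ^ 2) := by gcongr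
      _ = ((1 - δ) ^ (t + 1)) ^ 2 * π ⬝ᵥ f ^ 2 := by ring

theorem eq_zero_of_mulVec_eq_self (h : HasAbsoluteGap P π δ) (hδ : 0 < δ) (hf : π ⬝ᵥ f = 0)
    (hPf : P *ᵥ f = f) : f = 0 := by
  refine h.eq_zero_of_dotProduct_sq_nonpos ?_
  have hrayleigh := (le_abs_self _).trans (h.abs_rayleigh_le f hf)
  rw [hPf, ← sq] at hrayleigh
  exact nonpos_of_mul_nonpos_right (by linarith) hδ

theorem isStationaryDistribution_iff (h : HasAbsoluteGap P π δ) (hδ : 0 < δ) (ν : S → ℝ) :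
    IsStationaryDistribution P ν ↔ ν = π := by
  refine ⟨?_, fun hν => hν ▸ h.isStationaryDistribution⟩
  rintro ⟨-, hsum, hstat⟩
  set f : S → ℝ := ν / π - 1 with hf
  have hπf : π * f = ν - π := by
    funext x
    simp only [hf, Pi.mul_apply, Pi.sub_apply, Pi.div_apply, Pi.one_apply]
    field_simp [(h.pos x).ne']
  have hmean : π ⬝ᵥ f = 0 := by
    calc π ⬝ᵥ f = ∑ x, (ν - π) x := by rw [← hπf]; rfl
      _ = 0 := by simp [hsum, h.sum_eq_one]
  have hfix : P *ᵥ f = f := by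
    have hmul : π * P *ᵥ f = π * f := by rw [← h.mul_vecMul, hπf, sub_vecMul, hstat, h.vecMul_eq]
    funext x
    exact mul_left_cancel₀ (h.pos x).ne' (congrFun hmul x)
  rw [h.eq_zero_of_mulVec_eq_self hδ hmean hfix, mul_zero, eq_comm, sub_eq_zero] at hπf
  exact hπf

theorem sum_abs_pow_sub_sq_le (h : HasAbsoluteGap P π δ) (hδ : δ < 1) (x : S) (t : ℕ) :
    (∑ y, |(P ^ t) x y - π y|) ^ 2 ≤ ((1 - δ) ^ t) ^ 2 * (π x)⁻¹ := by
  set f : S → ℝ := Pi.single x (π x)⁻¹ - 1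
  have hdensity (y : S) : |(P ^ t) x y - π y| = π y * |(P ^ t *ᵥ f) y| := by
    rw [← abs_of_pos (h.pos y), ← abs_mul, abs_of_pos (h.pos y)]
    exact congrArg _ (congrFun ((h.pow t).row_sub_eq x) y)
  calc (∑ y, |(P ^ t) x y - π y|) ^ 2 = (∑ y, π y * |(P ^ t *ᵥ f) y|) ^ 2 := by
        simp only [hdensity]
    _ ≤ ∑ y, π y * |(P ^ t *ᵥ f) y| ^ 2 := Real.pow_arith_mean_le_arith_mean_pow_of_even _ _ _
        (fun y _ => (h.pos y).le) h.sum_eq_one even_two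
    _ = π ⬝ᵥ (P ^ t *ᵥ f) ^ 2 := by simp only [sq_abs, dotProduct, Pi.pow_apply]
    _ ≤ ((1 - δ) ^ t) ^ 2 * π ⬝ᵥ f ^ 2 :=
        h.dotProduct_pow_mulVec_sq_le hδ (h.dotProduct_single_inv_sub_one x) t
    _ ≤ ((1 - δ) ^ t) ^ 2 * (π x)⁻¹ := by
        gcongr
        exact h.dotProduct_single_inv_sub_one_sq_le x

theorem tvDistance_le (h : HasAbsoluteGap P π δ) (hδ : δ < 1) {p : ℝ} (hp : 0 < p)
    (hπ : ∀ x, p ≤ π x) (t : ℕ) : tvDistance P π t ≤ 1 / 2 * ((1 - δ) ^ t / √p) := by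
  have := h.nonempty
  unfold tvDistance
  gcongr
  refine ciSup_le fun x => le_of_sq_le_sq ?_ (by have := sub_pos.2 hδ; positivity)
  calc (∑ y, |(P ^ t) x y - π y|) ^ 2 ≤ ((1 - δ) ^ t) ^ 2 * (π x)⁻¹ :=
        h.sum_abs_pow_sub_sq_le hδ x t
    _ ≤ ((1 - δ) ^ t) ^ 2 * p⁻¹ := by
        gcongr
        exact hπ x
    _ = ((1 - δ) ^ t / √p) ^ 2 := by rw [div_pow, Real.sq_sqrt hp.le, div_eq_mul_inv]

/-- The `1 / 2` in the total variation distance absorbs the rounding `exp δ ≤ 2`. -/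
theorem tvDistance_floor_le (h : HasAbsoluteGap P π δ) (hδ : 0 < δ)
    (hδ2 : δ ≤ Real.log 2) {p ε : ℝ} (hp : 0 < p) (hπ : ∀ x, p ≤ π x) (hε : 0 < ε) :
    tvDistance P π ⌊δ⁻¹ * (Real.log p⁻¹ + Real.log ε⁻¹)⌋₊ ≤ ε := by
  set T := δ⁻¹ * (Real.log p⁻¹ + Real.log ε⁻¹) with hT
  have hδ1 : δ < 1 := hδ2.trans_lt (by linarith [Real.log_two_lt_d9])
  have hp1 : p ≤ 1 := h.le_one_of_forall_le hπ
  have hexp : Real.exp (-(δ * T)) = p * ε := by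
    rw [hT, mul_inv_cancel_left₀ hδ.ne', Real.log_inv, Real.log_inv, ← neg_add, neg_neg,
      Real.exp_add, Real.exp_log hp, Real.exp_log hε]
  have hdecay : (1 - δ) ^ ⌊T⌋₊ ≤ 2 * (p * ε) := by
    calc (1 - δ) ^ ⌊T⌋₊ ≤ Real.exp (-δ) ^ ⌊T⌋₊ :=
          pow_le_pow_left₀ (sub_nonneg.2 hδ1.le) (Real.one_sub_le_exp_neg δ) _
      _ = Real.exp (⌊T⌋₊ * -δ) := (Real.exp_nat_mul _ _).symm
      _ ≤ Real.exp (Real.log 2 + -(δ * T)) := by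
          gcongr
          nlinarith [Nat.lt_floor_add_one T]
      _ = 2 * (p * ε) := by rw [Real.exp_add, Real.exp_log two_pos, hexp]
  calc tvDistance P π ⌊T⌋₊ ≤ 1 / 2 * ((1 - δ) ^ ⌊T⌋₊ / √p) := h.tvDistance_le hδ1 hp hπ _
    _ ≤ 1 / 2 * (2 * (p * ε) / √p) := by gcongr
    _ = p / √p * ε := by ring
    _ = √p * ε := by rw [Real.div_sqrt]
    _ ≤ ε := mul_le_of_le_one_left hε.le (Real.sqrt_le_one.2 hp1)

theorem exists_isMixingTime_le (h : HasAbsoluteGap P π δ) (hδ : 0 < δ)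
    (hδ2 : δ ≤ Real.log 2) {p ε : ℝ} (hp : 0 < p) (hπ : ∀ x, p ≤ π x) (hε : 0 < ε)
    (hε1 : ε ≤ 1) :
    ∃ τ : ℕ, IsMixingTime P π ε τ ∧ (τ : ℝ) ≤ δ⁻¹ * (Real.log p⁻¹ + Real.log ε⁻¹) := by
  have hmem := h.tvDistance_floor_le hδ hδ2 hp hπ hε
  have hT : 0 ≤ δ⁻¹ * (Real.log p⁻¹ + Real.log ε⁻¹) := by
    have hlogp := Real.log_nonneg ((one_le_inv₀ hp).2 (h.le_one_of_forall_le hπ))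
    have hlogε := Real.log_nonneg ((one_le_inv₀ hε).2 hε1)
    positivity
  classical
  refine ⟨Nat.find ⟨_, hmem⟩, Nat.isLeast_find ⟨_, hmem⟩, ?_⟩
  exact (Nat.cast_le.2 (Nat.find_min' ⟨_, hmem⟩ hmem)).trans (Nat.floor_le hT)

end HasAbsoluteGap

end Reversible

section PermutationAction

variable {G X : Type*} [Group G] [MulAction G X] [Fintype X]

theorem sum_smul_eq_sum (F : X → ℝ) (g : G) : ∑ x, F (g • x) = ∑ x, F x :=
  Equiv.sum_comp (MulAction.toPerm g) F

theorem card_mul_sum_smul [Fintype G] [MulAction.IsPretransitive G X] (F : X → ℝ) (x : X) :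
    Fintype.card X * ∑ g : G, F (g • x) = Fintype.card G * ∑ y, F y := by
  have hconst (y : X) : ∑ g : G, F (g • y) = ∑ g : G, F (g • x) := by
    obtain ⟨k, rfl⟩ := MulAction.exists_smul_eq G x y
    simp only [smul_smul]
    exact Equiv.sum_comp (Equiv.mulRight k) fun g => F (g • x)
  calc Fintype.card X * ∑ g : G, F (g • x) = ∑ y, ∑ g : G, F (g • y) := by simp [hconst]
    _ = ∑ g : G, ∑ y, F (g • y) := Finset.sum_comm
    _ = Fintype.card G * ∑ y, F y := by simp [sum_smul_eq_sum]

/-- The `ℓ²` distance between a function `f` on a `G`-set and its translate by `g`, as a length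
function of `g`. -/
noncomputable def displacement (f : X → ℝ) (g : G) : ℝ :=
  ‖WithLp.toLp 2 fun x => f x - f (g • x)‖

theorem displacement_nonneg (f : X → ℝ) (g : G) : 0 ≤ displacement f g :=
  norm_nonneg _

theorem displacement_sq (f : X → ℝ) (g : G) :
    displacement f g ^ 2 = ∑ x, (f x - f (g • x)) ^ 2 := by
  simp [displacement, EuclideanSpace.norm_sq_eq]

theorem displacement_one (f : X → ℝ) : displacement f (1 : G) = 0 := by
  rw [← sq_eq_zero_iff, displacement_sq]
  simp

theorem displacement_mul_le (f : X → ℝ) (g h : G) :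
    displacement f (g * h) ≤ displacement f g + displacement f h := by
  have hshift : ‖WithLp.toLp 2 fun x => f (h • x) - f (g • h • x)‖ = displacement f g := by
    rw [← sq_eq_sq₀ (norm_nonneg _) (displacement_nonneg f g), displacement_sq,
      EuclideanSpace.norm_sq_eq, ← sum_smul_eq_sum (fun x => (f x - f (g • x)) ^ 2) h]
    simp
  calc displacement f (g * h)
      = ‖WithLp.toLp 2 (fun x => f (h • x) - f (g • h • x)) +
          WithLp.toLp 2 (fun x => f x - f (h • x))‖ := by
        rw [displacement, ← WithLp.toLp_add]
        congr with x
        simp [mul_smul]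
    _ ≤ displacement f g + displacement f h := hshift ▸ norm_add_le _ _

variable {α : Type*} [DecidableEq α] [Fintype α] [MulAction (Equiv.Perm α) X]

/-- Multiplying `σ` by the transposition of `k` and `σ k` removes `k` from its support. -/
theorem displacement_le_sum_of_support_subset (f : X → ℝ) {B : α → ℝ}
    (hB : ∀ k a, displacement f (Equiv.swap k a) ≤ B k) {s : Finset α} {σ : Equiv.Perm α}
    (hσ : σ.support ⊆ s) : displacement f σ ≤ ∑ k ∈ s, B k := by
  induction s using Finset.induction_on generalizing σ with
  | empty =>
    rw [Finset.subset_empty, Equiv.Perm.support_eq_empty_iff] at hσ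
    simp [hσ, displacement_one]
  | insert k s hk ih =>
    have hsupport : (Equiv.swap k (σ k) * σ).support ⊆ s := fun a ha => by
      have ⟨ha, hak⟩ := Equiv.Perm.mem_support_swap_mul_imp_mem_support_ne ha
      exact (Finset.mem_insert.1 (hσ ha)).resolve_left hak
    calc displacement f σ
        = displacement f (Equiv.swap k (σ k) * (Equiv.swap k (σ k) * σ)) := by
          rw [Equiv.swap_mul_self_mul]
      _ ≤ displacement f (Equiv.swap k (σ k)) + displacement f (Equiv.swap k (σ k) * σ) :=
          displacement_mul_le f _ _
      _ ≤ B k + ∑ k ∈ s, B k := add_le_add (hB k _) (ih hsupport)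
      _ = ∑ k ∈ insert k s, B k := (Finset.sum_insert hk).symm

theorem sum_sq_sub_smul_le (f : X → ℝ) (σ : Equiv.Perm α) :
    ∑ x, (f x - f (σ • x)) ^ 2 ≤
      Fintype.card α * ∑ k, ∑ a : α, ∑ x, (f x - f (Equiv.swap k a • x)) ^ 2 := by
  set B : α → ℝ := fun k => √(∑ a, displacement f (Equiv.swap k a) ^ 2)
  have hB (k a : α) : displacement f (Equiv.swap k a) ≤ B k :=
    Real.le_sqrt_of_sq_le <| Finset.single_le_sum
      (f := fun a => displacement f (Equiv.swap k a) ^ 2) (fun _ _ => sq_nonneg _)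
      (Finset.mem_univ a)
  calc ∑ x, (f x - f (σ • x)) ^ 2 = displacement f σ ^ 2 := (displacement_sq f σ).symm
    _ ≤ (∑ k, B k) ^ 2 := by
        gcongr
        · exact displacement_nonneg f σ
        · exact displacement_le_sum_of_support_subset f hB (Finset.subset_univ _)
    _ ≤ Fintype.card α * ∑ k, B k ^ 2 := sq_sum_le_card_mul_sum_sq
    _ = Fintype.card α * ∑ k, ∑ a : α, ∑ x, (f x - f (Equiv.swap k a • x)) ^ 2 := by
        congr! 2 with k
        rw [Real.sq_sqrt (by positivity)]
        simp only [displacement_sq]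

theorem sum_sum_sq_sub_le [MulAction.IsPretransitive (Equiv.Perm α) X] (f : X → ℝ) :
    ∑ x, ∑ y, (f x - f y) ^ 2 ≤ Fintype.card X *
      (Fintype.card α * ∑ k, ∑ a : α, ∑ x, (f x - f (Equiv.swap k a • x)) ^ 2) := by
  have hcard : (0 : ℝ) < Fintype.card (Equiv.Perm α) := by exact_mod_cast Fintype.card_pos
  refine le_of_mul_le_mul_left ?_ hcard
  calc Fintype.card (Equiv.Perm α) * ∑ x, ∑ y, (f x - f y) ^ 2
      = Fintype.card X * ∑ x, ∑ σ : Equiv.Perm α, (f x - f (σ • x)) ^ 2 := by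
        rw [Finset.mul_sum, Finset.mul_sum]
        exact Finset.sum_congr rfl fun x _ => (card_mul_sum_smul (fun y => (f x - f y) ^ 2) x).symm
    _ = Fintype.card X * ∑ σ : Equiv.Perm α, ∑ x, (f x - f (σ • x)) ^ 2 := by
        rw [Finset.sum_comm]
    _ ≤ Fintype.card X * ∑ _σ : Equiv.Perm α,
          (Fintype.card α * ∑ k, ∑ a : α, ∑ x, (f x - f (Equiv.swap k a • x)) ^ 2) := by
        gcongr with σ
        exact sum_sq_sub_smul_le f σ
    _ = _ := by
        rw [Finset.sum_const, Finset.card_univ, nsmul_eq_mul]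
        ring

end PermutationAction

section Embeddings

variable {m n : ℕ}

theorem exists_mem_of_isPerfectMatching (hmn : m ≤ n) {M : Finset (Fin m × Fin n)}
    (hM : IsPerfectMatching M) (y : Fin m) : ∃ z, (y, z) ∈ M := by
  by_contra! hy
  obtain ⟨hmatching, hmax⟩ := isPerfectMatching_iff.1 hM
  choose c hc using fun z => (hmax y z).resolve_left fun ⟨b, hb⟩ => hy b hb
  have hinj : Function.Injective c := fun z z' hz =>
    (isMatching_iff.1 hmatching).1 (c z) z z' (hc z) (hz ▸ hc z')
  obtain ⟨z, hz⟩ := (hinj.bijective_of_nat_card_le (by simpa using hmn)).surjective y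
  exact hy z (hz ▸ hc z)

/-- The perfect matching whose edges are the pairs `(y, φ y)`. -/
def ofEmbedding (φ : Fin m ↪ Fin n) : PerfectMatching m n :=
  ⟨Finset.univ.filter fun e => φ e.1 = e.2, by
    simp only [isPerfectMatching_iff, isMatching_iff, Finset.mem_filter_univ]
    exact ⟨⟨fun a b b' h h' => h.symm.trans h', fun a a' b h h' => φ.injective (h.trans h'.symm)⟩,
      fun a b => .inl ⟨φ a, rfl⟩⟩⟩

theorem mem_ofEmbedding {φ : Fin m ↪ Fin n} {a : Fin m} {b : Fin n} :
    (a, b) ∈ (ofEmbedding φ).1 ↔ φ a = b := by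
  simp [ofEmbedding]

theorem ofEmbedding_injective :
    Function.Injective (ofEmbedding : (Fin m ↪ Fin n) → PerfectMatching m n) := by
  intro φ ψ h
  ext a : 1
  exact (mem_ofEmbedding.1 (h ▸ mem_ofEmbedding.2 rfl : (a, φ a) ∈ (ofEmbedding ψ).1)).symm

theorem ofEmbedding_bijective (hmn : m ≤ n) :
    Function.Bijective (ofEmbedding : (Fin m ↪ Fin n) → PerfectMatching m n) := by
  refine ⟨ofEmbedding_injective, fun M => ?_⟩
  choose φ hφ using exists_mem_of_isPerfectMatching hmn M.2
  obtain ⟨hright, hleft⟩ := isMatching_iff.1 M.2.1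
  refine ⟨⟨φ, fun a a' h => hleft a a' (φ a) (hφ a) (h ▸ hφ a')⟩, Subtype.ext (Finset.ext ?_)⟩
  rintro ⟨a, b⟩
  rw [mem_ofEmbedding]
  exact ⟨fun h => h ▸ hφ a, hright a _ _ (hφ a)⟩

theorem propose_ofEmbedding (φ : Fin m ↪ Fin n) (y : Fin m) (z : Fin n) :
    propose (ofEmbedding φ) y z = ofEmbedding (Equiv.swap (φ y) z • φ) := by
  refine Subtype.ext (Finset.ext ?_)
  rintro ⟨a, b⟩
  have hinj : φ a = φ y ↔ a = y := φ.injective.eq_iff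
  rw [mem_ofEmbedding, propose, mem_proposalEdges]
  simp only [mem_ofEmbedding, Function.Embedding.smul_apply, Equiv.Perm.smul_def,
    Equiv.swap_apply_def]
  grind

theorem propose_ofEmbedding_eq_iff {φ ψ : Fin m ↪ Fin n} {y : Fin m} {z : Fin n} :
    propose (ofEmbedding φ) y z = ofEmbedding ψ ↔ z = ψ y ∧ Equiv.swap (φ y) (ψ y) • φ = ψ := by
  rw [propose_ofEmbedding, ofEmbedding_injective.eq_iff]
  constructor
  · rintro rfl
    simp
  · rintro ⟨rfl, h⟩
    exact h

/-- The number of choices `(y, z)` for which `M'` is proposed from `M`. -/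
def proposalCount (M M' : PerfectMatching m n) : ℕ :=
  Finset.card {e : Fin m × Fin n | propose M e.1 e.2 = M'}

theorem adjacent_iff_proposalCount_pos {M M' : PerfectMatching m n} :
    Adjacent M M' ↔ M ≠ M' ∧ 0 < proposalCount M M' := by
  simp [Adjacent, proposalCount, Finset.card_pos, Finset.filter_nonempty_iff]

theorem proposalCount_ofEmbedding (φ ψ : Fin m ↪ Fin n) :
    proposalCount (ofEmbedding φ) (ofEmbedding ψ) =
      Finset.card {y | Equiv.swap (φ y) (ψ y) • φ = ψ} := by
  refine Finset.card_nbij' Prod.fst (fun y => (y, ψ y)) ?_ ?_ ?_ ?_ <;>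
    simp +contextual [Set.MapsTo, Set.LeftInvOn, propose_ofEmbedding_eq_iff]

theorem proposalCount_comm (hmn : m ≤ n) (M M' : PerfectMatching m n) :
    proposalCount M M' = proposalCount M' M := by
  obtain ⟨φ, rfl⟩ := (ofEmbedding_bijective hmn).surjective M
  obtain ⟨ψ, rfl⟩ := (ofEmbedding_bijective hmn).surjective M'
  rw [proposalCount_ofEmbedding, proposalCount_ofEmbedding]
  simp only [Equiv.swap_comm (ψ _), ← eq_inv_smul_iff (b := ψ), Equiv.swap_inv, eq_comm (a := φ)]

theorem le_proposalCount_self (hmn : m ≤ n) (M : PerfectMatching m n) : m ≤ proposalCount M M := by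
  obtain ⟨φ, rfl⟩ := (ofEmbedding_bijective hmn).surjective M
  simp [proposalCount_ofEmbedding, ← Equiv.Perm.one_def]

theorem Adjacent.symm (hmn : m ≤ n) {M M' : PerfectMatching m n} (h : Adjacent M M') :
    Adjacent M' M := by
  rw [adjacent_iff_proposalCount_pos] at h ⊢
  exact ⟨h.1.symm, proposalCount_comm hmn M M' ▸ h.2⟩

theorem eq_or_eq_of_swap_smul_eq {α β : Type*} [DecidableEq β] {φ ψ : α ↪ β} {y : α}
    (hy : φ y ≠ ψ y) {k a : β} (h : Equiv.swap k a • φ = ψ) :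
    (k, a) = (φ y, ψ y) ∨ (k, a) = (ψ y, φ y) := by
  have happly : Equiv.swap k a (φ y) = ψ y := by rw [← h]; rfl
  rw [Equiv.swap_apply_def] at happly
  grind

theorem card_swap_smul_eq_le_two {α β : Type*} [Fintype β] [DecidableEq β] [DecidableEq (α ↪ β)]
    {φ ψ : α ↪ β} (h : φ ≠ ψ) : Finset.card {e : β × β | Equiv.swap e.1 e.2 • φ = ψ} ≤ 2 := by
  obtain ⟨y, hy⟩ := DFunLike.ne_iff.1 h
  refine (Finset.card_le_card (t := {(φ y, ψ y), (ψ y, φ y)}) fun e he => ?_).trans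
    Finset.card_le_two
  simpa using eq_or_eq_of_swap_smul_eq hy (Finset.mem_filter.1 he).2

theorem adjacent_ofEmbedding_swap_smul {φ : Fin m ↪ Fin n} {k a : Fin n}
    (h : Equiv.swap k a • φ ≠ φ) : Adjacent (ofEmbedding φ) (ofEmbedding (Equiv.swap k a • φ)) := by
  refine ⟨ofEmbedding_injective.ne h.symm, ?_⟩
  obtain ⟨y, hy⟩ := DFunLike.ne_iff.1 h.symm
  rcases eq_or_eq_of_swap_smul_eq hy rfl with hka | hka <;> rw [Prod.mk.injEq] at hka
  · exact ⟨y, a, by rw [propose_ofEmbedding, ← hka.1]⟩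
  · exact ⟨y, k, by rw [propose_ofEmbedding, ← hka.2, Equiv.swap_comm]⟩

theorem sum_swap_smul_le (hmn : m ≤ n) {φ : Fin m ↪ Fin n} {h : PerfectMatching m n → ℝ}
    (hnonneg : ∀ M, 0 ≤ h M) (hφ : h (ofEmbedding φ) = 0) :
    ∑ k : Fin n, ∑ a : Fin n, h (ofEmbedding (Equiv.swap k a • φ)) ≤
      2 * ∑ M with Adjacent (ofEmbedding φ) M, h M := by
  set g : Fin n × Fin n → PerfectMatching m n := fun e => ofEmbedding (Equiv.swap e.1 e.2 • φ)
  have hfiber (M : PerfectMatching m n) :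
      ∑ e with g e = M, h (g e) ≤ if Adjacent (ofEmbedding φ) M then 2 * h M else 0 := by
    obtain ⟨ψ, rfl⟩ := (ofEmbedding_bijective hmn).surjective M
    split_ifs with hadj
    · calc ∑ e with g e = ofEmbedding ψ, h (g e)
          = Finset.card {e | g e = ofEmbedding ψ} * h (ofEmbedding ψ) := by
            rw [Finset.sum_congr rfl fun e he => congrArg h (Finset.mem_filter.1 he).2,
              Finset.sum_const, nsmul_eq_mul]
        _ ≤ 2 * h (ofEmbedding ψ) := by
            refine mul_le_mul_of_nonneg_right ?_ (hnonneg _)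
            simp only [g, ofEmbedding_injective.eq_iff]
            exact_mod_cast card_swap_smul_eq_le_two (ofEmbedding_injective.ne_iff.1 hadj.1)
    · refine Finset.sum_nonpos fun e he => ?_
      have hfix : Equiv.swap e.1 e.2 • φ = φ := by
        by_contra hmoves
        exact hadj ((Finset.mem_filter.1 he).2 ▸ adjacent_ofEmbedding_swap_smul hmoves)
      simp only [g, hfix, hφ, le_refl]
  calc ∑ k : Fin n, ∑ a : Fin n, h (ofEmbedding (Equiv.swap k a • φ))
      = ∑ e, h (g e) := (Fintype.sum_prod_type' _).symm
    _ = ∑ M, ∑ e with g e = M, h (g e) := (Finset.sum_fiberwise _ _ _).symm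
    _ ≤ ∑ M, if Adjacent (ofEmbedding φ) M then 2 * h M else 0 := by
        gcongr with M
        exact hfiber M
    _ = 2 * ∑ M with Adjacent (ofEmbedding φ) M, h M := by
        rw [← Finset.sum_filter, Finset.mul_sum]

theorem sum_sum_sum_sq_sub_swap_smul_le (hmn : m ≤ n) (F : PerfectMatching m n → ℝ) :
    ∑ k : Fin n, ∑ a : Fin n, ∑ φ : Fin m ↪ Fin n,
        (F (ofEmbedding φ) - F (ofEmbedding (Equiv.swap k a • φ))) ^ 2 ≤
      2 * ∑ M, ∑ M' with Adjacent M M', (F M - F M') ^ 2 := by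
  calc ∑ k : Fin n, ∑ a : Fin n, ∑ φ : Fin m ↪ Fin n,
        (F (ofEmbedding φ) - F (ofEmbedding (Equiv.swap k a • φ))) ^ 2
      = ∑ φ, ∑ k : Fin n, ∑ a : Fin n,
          (F (ofEmbedding φ) - F (ofEmbedding (Equiv.swap k a • φ))) ^ 2 := by
        rw [Finset.sum_congr rfl fun k _ => Finset.sum_comm, Finset.sum_comm]
    _ ≤ ∑ φ : Fin m ↪ Fin n,
          2 * ∑ M' with Adjacent (ofEmbedding φ) M', (F (ofEmbedding φ) - F M') ^ 2 :=
        Finset.sum_le_sum fun φ _ =>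
          sum_swap_smul_le (h := fun M' => (F (ofEmbedding φ) - F M') ^ 2) hmn
            (fun _ => sq_nonneg _) (by simp)
    _ = 2 * ∑ M, ∑ M' with Adjacent M M', (F M - F M') ^ 2 := by
        rw [← Finset.mul_sum, (ofEmbedding_bijective hmn).sum_comp fun M =>
          ∑ M' with Adjacent M M', (F M - F M') ^ 2]

/-- The Poincaré inequality of the adjacency graph of perfect matchings. -/
theorem sum_sum_sq_sub_le_adjacent (hmn : m ≤ n) (F : PerfectMatching m n → ℝ) :
    ∑ M, ∑ M', (F M - F M') ^ 2 ≤ Fintype.card (PerfectMatching m n) *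
      (2 * n * ∑ M, ∑ M' with Adjacent M M', (F M - F M') ^ 2) := by
  have hbij := ofEmbedding_bijective hmn
  have : MulAction.IsPretransitive (Equiv.Perm (Fin n)) (Fin m ↪ Fin n) :=
    Equiv.Perm.isMultiplyPretransitive (Fin n) m
  have htotal : ∑ M, ∑ M', (F M - F M') ^ 2 =
      ∑ φ, ∑ ψ, (F (ofEmbedding φ) - F (ofEmbedding ψ)) ^ 2 := by
    rw [← hbij.sum_comp]
    exact Finset.sum_congr rfl fun φ _ => (hbij.sum_comp _).symm
  calc ∑ M, ∑ M', (F M - F M') ^ 2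
      ≤ Fintype.card (Fin m ↪ Fin n) * (Fintype.card (Fin n) * ∑ k : Fin n, ∑ a : Fin n, ∑ φ,
          (F (ofEmbedding φ) - F (ofEmbedding (Equiv.swap k a • φ))) ^ 2) :=
        htotal ▸ sum_sum_sq_sub_le fun φ : Fin m ↪ Fin n => F (ofEmbedding φ)
    _ ≤ Fintype.card (PerfectMatching m n) *
          (n * (2 * ∑ M, ∑ M' with Adjacent M M', (F M - F M') ^ 2)) := by
        rw [Fintype.card_of_bijective hbij, Fintype.card_fin]
        gcongr
        exact sum_sum_sum_sq_sub_swap_smul_le hmn F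
    _ = Fintype.card (PerfectMatching m n) *
          (2 * n * ∑ M, ∑ M' with Adjacent M M', (F M - F M') ^ 2) := by ring

theorem card_perfectMatching_le (hmn : m ≤ n) : Fintype.card (PerfectMatching m n) ≤ n ^ m := by
  rw [← Fintype.card_of_bijective (ofEmbedding_bijective hmn), Fintype.card_embedding_eq]
  simpa using Nat.descFactorial_le_pow n m

theorem nonempty_perfectMatching (hmn : m ≤ n) : Nonempty (PerfectMatching m n) :=
  ⟨ofEmbedding (Fin.castLEEmb hmn)⟩

end Embeddings

section Gibbs

variable {m n : ℕ} {β : ℝ} {U : PerfectMatching m n → ℝ}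

theorem acceptProb_le_one (M M' : PerfectMatching m n) : acceptProb β U M M' ≤ 1 :=
  min_le_left _ _

theorem acceptProb_nonneg (M M' : PerfectMatching m n) : 0 ≤ acceptProb β U M M' :=
  le_min zero_le_one (Real.exp_pos _).le

theorem acceptProb_self (M : PerfectMatching m n) : acceptProb β U M M = 1 := by
  simp [acceptProb]

theorem sum_exp_pos [Nonempty (PerfectMatching m n)] :
    0 < ∑ M : PerfectMatching m n, Real.exp (β * U M) :=
  Finset.sum_pos (fun _ _ => Real.exp_pos _) Finset.univ_nonempty

theorem gibbs_pos (M : PerfectMatching m n) : 0 < gibbs β U M :=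
  have : Nonempty (PerfectMatching m n) := ⟨M⟩
  div_pos (Real.exp_pos _) sum_exp_pos

theorem sum_gibbs [Nonempty (PerfectMatching m n)] : ∑ M, gibbs β U M = 1 := by
  simp only [gibbs, ← Finset.sum_div]
  exact div_self sum_exp_pos.ne'

theorem gibbs_mul_exp (M : PerfectMatching m n) (x : ℝ) :
    gibbs β U M * Real.exp x =
      Real.exp (β * U M + x) / ∑ M' : PerfectMatching m n, Real.exp (β * U M') := by
  rw [gibbs, div_mul_eq_mul_div, ← Real.exp_add]

theorem gibbs_mul_acceptProb (M M' : PerfectMatching m n) :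
    gibbs β U M * acceptProb β U M M' = min (gibbs β U M) (gibbs β U M') := by
  rw [acceptProb, mul_min_of_nonneg _ _ (gibbs_pos M).le, mul_one, gibbs_mul_exp, mul_sub,
    add_sub_cancel, ← gibbs]

theorem gibbs_mul_acceptProb_comm (M M' : PerfectMatching m n) :
    gibbs β U M * acceptProb β U M M' = gibbs β U M' * acceptProb β U M' M := by
  rw [gibbs_mul_acceptProb, gibbs_mul_acceptProb, min_comm]

theorem mul_sub_le_mul_Umax_sub_Umin (hβ : 0 ≤ β) (M M' : PerfectMatching m n) :
    β * (U M - U M') ≤ β * (Umax U - Umin U) := by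
  gcongr
  · exact le_ciSup (Set.finite_range U).bddAbove M
  · exact ciInf_le (Set.finite_range U).bddBelow M'

theorem mul_Umax_sub_Umin_nonneg [Nonempty (PerfectMatching m n)] (hβ : 0 ≤ β) :
    0 ≤ β * (Umax U - Umin U) := by
  obtain ⟨M⟩ := ‹Nonempty (PerfectMatching m n)›
  simpa using mul_sub_le_mul_Umax_sub_Umin (U := U) hβ M M

theorem alpha_pos : 0 < alpha β U :=
  Real.exp_pos _

theorem one_le_alpha [Nonempty (PerfectMatching m n)] (hβ : 0 ≤ β) : 1 ≤ alpha β U :=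
  Real.one_le_exp (mul_Umax_sub_Umin_nonneg hβ)

theorem gibbs_le_alpha_mul_gibbs (hβ : 0 ≤ β) (M M' : PerfectMatching m n) :
    gibbs β U M ≤ alpha β U * gibbs β U M' := by
  rw [mul_comm, alpha, gibbs_mul_exp, gibbs]
  gcongr
  linarith [mul_sub_le_mul_Umax_sub_Umin (U := U) hβ M M']

theorem inv_alpha_mul_pow_le_gibbs (hmn : m ≤ n) (hβ : 0 ≤ β) (M : PerfectMatching m n) :
    (alpha β U * (n : ℝ) ^ m)⁻¹ ≤ gibbs β U M := by
  have : Nonempty (PerfectMatching m n) := ⟨M⟩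
  have hcard : (Fintype.card (PerfectMatching m n) : ℝ) ≤ (n : ℝ) ^ m := by
    exact_mod_cast card_perfectMatching_le hmn
  have hpow : (0 : ℝ) < (n : ℝ) ^ m := hcard.trans_lt' (by exact_mod_cast Fintype.card_pos)
  rw [inv_le_iff_one_le_mul₀ (mul_pos alpha_pos hpow)]
  calc 1 = ∑ M', gibbs β U M' := sum_gibbs.symm
    _ ≤ ∑ _M' : PerfectMatching m n, alpha β U * gibbs β U M :=
        Finset.sum_le_sum fun M' _ => gibbs_le_alpha_mul_gibbs hβ M' M
    _ = Fintype.card (PerfectMatching m n) * (alpha β U * gibbs β U M) := by simp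
    _ ≤ (n : ℝ) ^ m * (alpha β U * gibbs β U M) := by
        have := (alpha_pos (β := β) (U := U)).le
        have := (gibbs_pos (β := β) (U := U) M).le
        gcongr
    _ = gibbs β U M * (alpha β U * (n : ℝ) ^ m) := by ring

end Gibbs

section MetropolisChains

variable {m n : ℕ} {β : ℝ} {U : PerfectMatching m n → ℝ}
  {P : Matrix (PerfectMatching m n) (PerfectMatching m n) ℝ}

/-- What the algorithm and its lazy form have in common: a chain that is reversible with respect to
the Gibbs distribution, makes each admissible move at least at the rate of the lazy form, and holds
with probability at least `1 / (2n)`. -/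
structure IsMetropolisChain (β : ℝ) (U : PerfectMatching m n → ℝ)
    (P : Matrix (PerfectMatching m n) (PerfectMatching m n) ℝ) : Prop where
  isReversible : IsReversible P (gibbs β U)
  le_apply_of_adjacent {M M' : PerfectMatching m n} :
    Adjacent M M' → 1 / (2 * (m : ℝ) * n) * acceptProb β U M M' ≤ P M M'
  le_apply_self (M : PerfectMatching m n) : 1 / (2 * (n : ℝ)) ≤ P M M

theorem eight_mul_le_mul_sq_mul_alpha (hm : 1 ≤ m) (hmn : m ≤ n) (hβ : 0 ≤ β) :
    8 * (n : ℝ) ≤ 8 * m * n ^ 2 * alpha β U := by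
  have := nonempty_perfectMatching hmn
  have hα : 1 ≤ alpha β U := one_le_alpha hβ
  calc 8 * (n : ℝ) = 8 * (1 : ℕ) * n ^ 1 * 1 := by simp
    _ ≤ 8 * m * n ^ 2 * alpha β U := by
        gcongr
        · exact_mod_cast hm.trans hmn
        · norm_num

theorem mul_sq_mul_alpha_le (hm : 1 ≤ m) (hmn : m ≤ n) (hβ : 0 ≤ β) :
    8 * (m : ℝ) * n ^ 2 * alpha β U ≤ 32 * m ^ 2 * n ^ 2 * alpha β U ^ 6 := by
  have := nonempty_perfectMatching hmn
  have hα : 1 ≤ alpha β U := one_le_alpha hβ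
  have hm' : (1 : ℝ) ≤ m := by exact_mod_cast hm
  gcongr
  · norm_num
  · exact le_self_pow₀ hm' two_ne_zero
  · exact le_self_pow₀ hα (by norm_num)

theorem mul_Umax_sub_Umin_add_log_nonneg (hmn : m ≤ n) (hβ : 0 ≤ β) {ε : ℝ} (hε : 0 < ε)
    (hε1 : ε ≤ 1) : 0 ≤ β * (Umax U - Umin U) + m * Real.log n + Real.log ε⁻¹ := by
  have := nonempty_perfectMatching hmn
  have hU := mul_Umax_sub_Umin_nonneg (U := U) hβ
  have hlog := Real.log_nonneg ((one_le_inv₀ hε).2 hε1)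
  have := Real.log_natCast_nonneg n
  positivity

theorem IsMetropolisChain.hasAbsoluteGap (h : IsMetropolisChain β U P) (hm : 1 ≤ m) (hmn : m ≤ n)
    (hβ : 0 ≤ β) : HasAbsoluteGap P (gibbs β U) (8 * m * n ^ 2 * alpha β U)⁻¹ := by
  have : (1 : ℝ) ≤ m := by exact_mod_cast hm
  have hn : (1 : ℝ) ≤ n := by exact_mod_cast hm.trans hmn
  have hα : 0 < alpha β U := alpha_pos
  refine h.isReversible.hasAbsoluteGap (fun f hf => ?_) fun M => ?_
  · have hcomparison := h.isReversible.mul_dotProduct_sq_le_dirichletForm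
      (r := Adjacent) (c := 1 / (2 * (m : ℝ) * n)) (K := 2 * n)
      (gibbs_le_alpha_mul_gibbs hβ) (by positivity) (by positivity)
      (fun M M' hadj => ?_) hf (sum_sum_sq_sub_le_adjacent hmn f)
    · rw [inv_mul_le_iff₀ (by positivity)]
      rw [div_mul_eq_mul_div, div_le_iff₀ (by positivity)] at hcomparison
      linarith
    · rw [← gibbs_mul_acceptProb, mul_left_comm]
      exact mul_le_mul_of_nonneg_left (h.le_apply_of_adjacent hadj) (gibbs_pos M).le
  · calc (8 * m * n ^ 2 * alpha β U)⁻¹ ≤ (n : ℝ)⁻¹ := by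
          gcongr
          linarith [eight_mul_le_mul_sq_mul_alpha (U := U) hm hmn hβ]
      _ = 2 * (1 / (2 * (n : ℝ))) := by field_simp
      _ ≤ 2 * P M M := mul_le_mul_of_nonneg_left (h.le_apply_self M) zero_le_two

theorem algorithmMatrix_apply (M M' : PerfectMatching m n) :
    algorithmMatrix β U M M' = 1 / ((m : ℝ) * n) * (proposalCount M M' * acceptProb β U M M' +
      if M = M' then ∑ e : Fin m × Fin n, (1 - acceptProb β U M (propose M e.1 e.2)) else 0) := by
  have hproposed : ∑ e : Fin m × Fin n,
      (if propose M e.1 e.2 = M' then acceptProb β U M (propose M e.1 e.2) else 0) =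
        proposalCount M M' * acceptProb β U M M' := by
    rw [← Finset.sum_filter, Finset.sum_congr rfl fun e he =>
      congrArg (acceptProb β U M) (Finset.mem_filter.1 he).2, Finset.sum_const, nsmul_eq_mul,
      proposalCount]
  rw [algorithmMatrix, ← Fintype.sum_prod_type', ← Finset.mul_sum, Finset.sum_add_distrib,
    hproposed]
  split_ifs <;> simp

theorem le_algorithmMatrix (M M' : PerfectMatching m n) :
    1 / ((m : ℝ) * n) * (proposalCount M M' * acceptProb β U M M') ≤ algorithmMatrix β U M M' := by
  rw [algorithmMatrix_apply]
  gcongr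
  refine le_add_of_nonneg_right ?_
  split_ifs
  · exact Finset.sum_nonneg fun e _ => sub_nonneg.2 (acceptProb_le_one M _)
  · exact le_rfl

theorem isReversible_algorithmMatrix (hm : 1 ≤ m) (hmn : m ≤ n) :
    IsReversible (algorithmMatrix β U) (gibbs β U) where
  mem_rowStochastic := by
    refine Matrix.mem_rowStochastic_iff_sum.2 ⟨fun M M' => ?_, fun M => ?_⟩
    · have := acceptProb_nonneg (β := β) (U := U) M M'
      exact le_trans (by positivity) (le_algorithmMatrix M M')
    · have hm' : (m : ℝ) ≠ 0 := by exact_mod_cast (by omega : m ≠ 0)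
      have hn' : (n : ℝ) ≠ 0 := by exact_mod_cast (by omega : n ≠ 0)
      simp only [algorithmMatrix]
      rw [Finset.sum_comm, Finset.sum_congr rfl fun y _ => Finset.sum_comm]
      simp [← Finset.mul_sum, Finset.sum_add_distrib]
      field_simp
  pos := gibbs_pos
  sum_eq_one :=
    have := nonempty_perfectMatching hmn
    sum_gibbs
  balance M M' := by
    rcases eq_or_ne M M' with rfl | hne
    · rfl
    · rw [algorithmMatrix_apply, algorithmMatrix_apply, if_neg hne, if_neg hne.symm,
        proposalCount_comm hmn M M']
      linear_combination (1 / ((m : ℝ) * n) * proposalCount M' M) *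
        gibbs_mul_acceptProb_comm (β := β) (U := U) M M'

theorem isMetropolisChain_algorithmMatrix (hm : 1 ≤ m) (hmn : m ≤ n) :
    IsMetropolisChain β U (algorithmMatrix β U) where
  isReversible := isReversible_algorithmMatrix hm hmn
  le_apply_of_adjacent {M M'} hadj := by
    have hcount : (1 : ℝ) ≤ proposalCount M M' := by
      exact_mod_cast (adjacent_iff_proposalCount_pos.1 hadj).2
    have haccept := acceptProb_nonneg (β := β) (U := U) M M'
    calc 1 / (2 * (m : ℝ) * n) * acceptProb β U M M'
        = 1 / ((m : ℝ) * n) * (1 / 2 * acceptProb β U M M') := by ring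
      _ ≤ 1 / ((m : ℝ) * n) * (proposalCount M M' * acceptProb β U M M') := by
          gcongr
          linarith
      _ ≤ algorithmMatrix β U M M' := le_algorithmMatrix M M'
  le_apply_self M := by
    have hcount : (m : ℝ) ≤ proposalCount M M := by exact_mod_cast le_proposalCount_self hmn M
    have hm' : (m : ℝ) ≠ 0 := by exact_mod_cast (by omega : m ≠ 0)
    calc 1 / (2 * (n : ℝ)) ≤ 1 / n := by
          rw [one_div, one_div, mul_inv]
          exact mul_le_of_le_one_left (by positivity) (by norm_num)
      _ = 1 / ((m : ℝ) * n) * m := by field_simp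
      _ ≤ 1 / ((m : ℝ) * n) * (proposalCount M M * acceptProb β U M M) := by
          rw [acceptProb_self, mul_one]
          gcongr
      _ ≤ algorithmMatrix β U M M := le_algorithmMatrix M M

theorem lazyMatrix_eq (β : ℝ) (U : PerfectMatching m n → ℝ) (M M' : PerfectMatching m n) :
    lazyMatrix β U M M' =
      (if Adjacent M M' then 1 / (2 * (m : ℝ) * n) * acceptProb β U M M' else 0) +
      if M = M' then 1 - ∑ N with Adjacent M N, 1 / (2 * (m : ℝ) * n) * acceptProb β U M N
        else 0 := by
  rw [Finset.sum_filter, lazyMatrix]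
  split_ifs with hMM' hadj hadj
  · exact absurd hMM' hadj.1
  all_goals simp

theorem card_adjacent_le (M : PerfectMatching m n) :
    Finset.card {M' | Adjacent M M'} ≤ m * n := by
  have hsub : ({M' | Adjacent M M'} : Finset _) ⊆
      (Finset.univ : Finset (Fin m × Fin n)).image fun e => propose M e.1 e.2 := fun M' hM' => by
    obtain ⟨-, y, z, h⟩ := (Finset.mem_filter.1 hM').2
    exact Finset.mem_image.2 ⟨(y, z), Finset.mem_univ _, h⟩
  simpa using (Finset.card_le_card hsub).trans Finset.card_image_le

theorem half_le_lazyMatrix_self (M : PerfectMatching m n) : 1 / 2 ≤ lazyMatrix β U M M := by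
  have hcard : (Finset.card {M' | Adjacent M M'} : ℝ) ≤ m * n := by
    exact_mod_cast card_adjacent_le M
  have hleave : ∑ N with Adjacent M N, 1 / (2 * (m : ℝ) * n) * acceptProb β U M N ≤ 1 / 2 := by
    calc ∑ N with Adjacent M N, 1 / (2 * (m : ℝ) * n) * acceptProb β U M N
        ≤ ∑ N with Adjacent M N, 1 / (2 * (m : ℝ) * n) := Finset.sum_le_sum fun N _ =>
          mul_le_of_le_one_right (by positivity) (acceptProb_le_one M N)
      _ = Finset.card {M' | Adjacent M M'} / (2 * (m * n : ℝ)) := by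
          rw [Finset.sum_const, nsmul_eq_mul, mul_one_div, mul_assoc]
      _ ≤ 1 / 2 := by
          refine div_le_of_le_mul₀ (by positivity) (by norm_num) ?_
          linarith
  have hadj : ¬Adjacent M M := fun h => h.1 rfl
  rw [lazyMatrix_eq, if_neg hadj, if_pos rfl]
  linarith

theorem isReversible_lazyMatrix (hmn : m ≤ n) : IsReversible (lazyMatrix β U) (gibbs β U) where
  mem_rowStochastic := by
    refine Matrix.mem_rowStochastic_iff_sum.2 ⟨fun M M' => ?_, fun M => ?_⟩
    · rcases eq_or_ne M M' with rfl | hne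
      · exact le_trans (by norm_num) (half_le_lazyMatrix_self M)
      · have := acceptProb_nonneg (β := β) (U := U) M M'
        rw [lazyMatrix_eq, if_neg hne, add_zero]
        positivity
    · simp only [lazyMatrix_eq, Finset.sum_add_distrib, Finset.sum_ite_eq, Finset.mem_univ, if_true]
      rw [← Finset.sum_filter, add_sub_cancel]
  pos := gibbs_pos
  sum_eq_one :=
    have := nonempty_perfectMatching hmn
    sum_gibbs
  balance M M' := by
    rcases eq_or_ne M M' with rfl | hne
    · rfl
    · have hadj : Adjacent M M' ↔ Adjacent M' M := ⟨.symm hmn, .symm hmn⟩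
      simp only [lazyMatrix_eq, if_neg hne, if_neg hne.symm, hadj]
      split_ifs
      · linear_combination 1 / (2 * (m : ℝ) * n) *
          gibbs_mul_acceptProb_comm (β := β) (U := U) M M'
      · simp

theorem isMetropolisChain_lazyMatrix (hm : 1 ≤ m) (hmn : m ≤ n) :
    IsMetropolisChain β U (lazyMatrix β U) where
  isReversible := isReversible_lazyMatrix hmn
  le_apply_of_adjacent hadj := by rw [lazyMatrix_eq, if_pos hadj, if_neg hadj.1, add_zero]
  le_apply_self M := by
    have hn : (1 : ℝ) ≤ n := by exact_mod_cast hm.trans hmn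
    calc 1 / (2 * (n : ℝ)) ≤ 1 / 2 := by gcongr; linarith
      _ ≤ lazyMatrix β U M M := half_le_lazyMatrix_self M

end MetropolisChains

end MatchingChain

theorem mainTheorem2_general (m n : ℕ) (hm : 1 ≤ m) (hmn : m ≤ n)
    (U : MatchingChain.PerfectMatching m n → ℝ) (β : ℝ) (hβ : 0 ≤ β)
    (ε : ℝ) (hε : 0 < ε) (hε1 : ε ≤ 1)
    (P : Matrix (MatchingChain.PerfectMatching m n) (MatchingChain.PerfectMatching m n) ℝ)
    (hP : MatchingChain.IsMetropolisChain β U P) :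
    (∀ π : MatchingChain.PerfectMatching m n → ℝ,
        MatchingChain.IsStationaryDistribution P π ↔ π = MatchingChain.gibbs β U) ∧
      ∃ τ : ℕ, MatchingChain.IsMixingTime P (MatchingChain.gibbs β U) ε τ ∧
        (τ : ℝ) ≤ 8 * (m : ℝ) * (n : ℝ) ^ 2 * MatchingChain.alpha β U *
          (β * (MatchingChain.Umax U - MatchingChain.Umin U) + m * Real.log n +
            Real.log ε⁻¹) := by
  have hn : 0 < n := hm.trans hmn
  have hα : 0 < MatchingChain.alpha β U := MatchingChain.alpha_pos
  have hgap := hP.hasAbsoluteGap hm hmn hβ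
  have hδ : 0 < (8 * m * n ^ 2 * MatchingChain.alpha β U)⁻¹ := by positivity
  have hδ2 : (8 * m * n ^ 2 * MatchingChain.alpha β U)⁻¹ ≤ Real.log 2 := by
    have hn' : (1 : ℝ) ≤ n := by exact_mod_cast hn
    calc (8 * m * n ^ 2 * MatchingChain.alpha β U)⁻¹ ≤ (8 : ℝ)⁻¹ := by
          gcongr
          linarith [MatchingChain.eight_mul_le_mul_sq_mul_alpha (U := U) hm hmn hβ]
      _ ≤ Real.log 2 := by linarith [Real.log_two_gt_d9]
  obtain ⟨τ, hτ, hle⟩ := hgap.exists_isMixingTime_le hδ hδ2 (by positivity)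
    (MatchingChain.inv_alpha_mul_pow_le_gibbs hmn hβ) hε hε1
  refine ⟨hgap.isStationaryDistribution_iff hδ, τ, hτ, ?_⟩
  rwa [inv_inv, inv_inv, Real.log_mul hα.ne' (by positivity), Real.log_pow, MatchingChain.alpha,
    Real.log_exp] at hle

theorem mainTheorem2 (m n : ℕ) (hm : 1 ≤ m) (hmn : m ≤ n)
    (U : MatchingChain.PerfectMatching m n → ℝ) (β : ℝ) (hβ : 0 ≤ β)
    (ε : ℝ) (hε : 0 < ε) (hε1 : ε ≤ 1)
    (P : Matrix (MatchingChain.PerfectMatching m n) (MatchingChain.PerfectMatching m n) ℝ)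
    (hP : P = MatchingChain.algorithmMatrix β U ∨ P = MatchingChain.lazyMatrix β U) :
    (∀ π : MatchingChain.PerfectMatching m n → ℝ,
        MatchingChain.IsStationaryDistribution P π ↔ π = MatchingChain.gibbs β U) ∧
      ∃ τ : ℕ, MatchingChain.IsMixingTime P (MatchingChain.gibbs β U) ε τ ∧
        (τ : ℝ) ≤ 32 * (m : ℝ) ^ 2 * (n : ℝ) ^ 2 * MatchingChain.alpha β U ^ 6 *
          (β * (MatchingChain.Umax U - MatchingChain.Umin U) + m * Real.log n +
            Real.log ε⁻¹) := by
  obtain ⟨hstat, τ, hτ, hle⟩ := mainTheorem2_general m n hm hmn U β hβ ε hε hε1 P <|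
    hP.elim (· ▸ MatchingChain.isMetropolisChain_algorithmMatrix hm hmn)
      (· ▸ MatchingChain.isMetropolisChain_lazyMatrix hm hmn)
  exact ⟨hstat, τ, hτ, hle.trans <| mul_le_mul_of_nonneg_right
    (MatchingChain.mul_sq_mul_alpha_le hm hmn hβ)
    (MatchingChain.mul_Umax_sub_Umin_add_log_nonneg hmn hβ hε hε1)⟩
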